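/- All graphs are finite and simple. A convex drawing of a graph places its vertices at distinct points of a circle and draws its edges as straight-line segments; two edges cross if their segments share an interior point. A graph is outer $k$-planar if it has a convex drawing in which every edge crosses at most $k$ other edges, and the convex local crossing number $\mathrm{lcr}^\circ(G)$ is the smallest $k$ such that $G$ is outer $k$-planar. A separation of a graph $H$ is a pair $(A,B)$ of vertex sets with $A\cup B=V(H)$ and no edge between $A\setminus B$ and $B\setminus A$; its order is $|A\cap B|$, and it is balanced if $|A\setminus B|\le \tfrac23|V(H)|$ and $|B\setminus A|\le\tfrac23|V(H)|$. The separation number $\mathrm{sn}(G)$ is the smallest integer $s$ such that every subgraph of $G$ has a balanced separation of order at most $s$. The stacked prism $Y_{m,n}$ is obtained from the $m\times n$ grid ($m$ rows, $n$ columns) by joining, in each column, the vertex of the first row to the vertex of the last row. Theorem. Let $k\ge 0$ be even. Then there is an $M=M(k)$ such that for every even $m\ge M$ the stacked prism $Y_{m,k/2+1}$ satisfies $\mathrm{lcr}^\circ(Y_{m,k/2+1})=k$ and $\mathrm{sn}(Y_{m,k/2+1})=k+2$. In particular, there is a graph $G$ with $\mathrm{lcr}^\circ(G)=k$ and $\mathrm{sn}(G)=k+2$.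 Moreover, every outer $k$-planar graph $G$ satisfies $\mathrm{sn}(G)\le k+2$, so this bound is tight. -/

import Mathlib

universe u

namespace SimpleGraph

/-- A convex drawing of a graph with vertex set `V`: the vertices are placed on pairwise different
points of a circle of the Euclidean plane (here `ℂ`), and every edge is the straight-line segment
between its endpoints. -/
structure ConvexDrawing (V : Type u) where
  /-- the centre of the circle -/
  center : ℂ
  /-- the radius of the circle -/
  radius : ℝ
  radius_pos : 0 < radius
  /-- the point representing a vertex -/
  pos : V → ℂ
  pos_injective : Function.Injective pos
  pos_mem_circle : ∀ v, pos v ∈ Metric.sphere center radius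

namespace ConvexDrawing

variable {V : Type u}

/-- The interior of the straight-line segment that represents the pair `e` of vertices. -/
def edgeInterior (D : ConvexDrawing V) (e : Sym2 V) : Set ℂ :=
  Sym2.lift ⟨fun v w => openSegment ℝ (D.pos v) (D.pos w),
    fun v w => openSegment_symm ℝ (D.pos v) (D.pos w)⟩ e

/-- Two different edges cross if their segments have a common interior point. -/
def Crosses (D : ConvexDrawing V) (e f : Sym2 V) : Prop :=
  e ≠ f ∧ (D.edgeInterior e ∩ D.edgeInterior f).Nonempty

/-- In the drawing `D` of `G`, every edge of `G` crosses at most `k` other edges of `G`. -/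
def IsOuterPlanarDrawing (D : ConvexDrawing V) (G : SimpleGraph V) (k : ℕ) : Prop :=
  ∀ e ∈ G.edgeSet, {f ∈ G.edgeSet | D.Crosses e f}.encard ≤ k

end ConvexDrawing

/-- `G` is outer `k`-planar: it has a convex drawing in which every edge crosses at most `k` other
edges. -/
def IsOuterKPlanar {V : Type u} (G : SimpleGraph V) (k : ℕ) : Prop :=
  ∃ D : ConvexDrawing V, D.IsOuterPlanarDrawing G k

/-- The convex local crossing number of `G`: the smallest `k` such that `G` is outer `k`-planar
(`⊤` if there is none). -/
noncomputable def convexLocalCrossingNumber {V : Type u} (G : SimpleGraph V) : ℕ∞ :=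
  ⨅ (k : ℕ) (_ : G.IsOuterKPlanar k), (k : ℕ∞)

/-- `(A, B)` is a separation of `G`: `A ∪ B` is the whole vertex set and no edge joins `A \ B`
and `B \ A`. -/
def IsSeparation {V : Type u} (G : SimpleGraph V) (A B : Set V) : Prop :=
  A ∪ B = Set.univ ∧ ∀ a ∈ A \ B, ∀ b ∈ B \ A, ¬ G.Adj a b

/-- The separation `(A, B)` of a finite graph `G` on `n` vertices is balanced: `A \ B` and `B \ A`
both have at most `2 * n / 3` elements (real division). -/
def IsBalancedSeparation {V : Type u} (G : SimpleGraph V) (A B : Set V) : Prop :=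
  G.IsSeparation A B ∧
    3 * (A \ B).ncard ≤ 2 * Nat.card V ∧ 3 * (B \ A).ncard ≤ 2 * Nat.card V

/-- Every subgraph of the finite graph `G` has a balanced separation of order at most `k`. -/
def HasSubgraphSeparations {V : Type u} (G : SimpleGraph V) (k : ℕ) : Prop :=
  ∀ H : G.Subgraph, ∃ A B : Set H.verts, H.coe.IsBalancedSeparation A B ∧ (A ∩ B).ncard ≤ k

/-- The separation number of a finite graph `G`: the smallest `k` such that every subgraph of `G`
has a balanced separation of order at most `k` (`⊤` if there is none). -/
noncomputable def separationNumber {V : Type u} (G : SimpleGraph V) : ℕ∞ :=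
  ⨅ (k : ℕ) (_ : G.HasSubgraphSeparations k), (k : ℕ∞)

/-- The `m × n` stacked prism: the grid with `m` rows and `n` columns, in which, in addition, the
first and the last vertex of every column are joined. The vertex `(i, j)` lies in row `i` and
column `j`; every column is a cycle and every row is a path. -/
def stackedPrism (m n : ℕ) : SimpleGraph (Fin m × Fin n) :=
  cycleGraph m □ pathGraph n

end SimpleGraph

/-! Upper bound. Number the n vertices along the circle. A chord, edge or not, with at most 2n/3
vertices strictly on each side and at most k crossing edges yields a balanced separation: take its
two ends and one end of every crossing edge (`exists_balancedSeparation_of_chord`). If some edge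
splits the circle this evenly, use it. Otherwise every edge has a short side of fewer than n/3
steps; let the load of a vertex be the number of edges whose short side covers it. A chord is
crossed at most as often as the loads of its ends sum to (`encard_interlaces_le`). For an edge ab
longest among those over some vertex, the loads of a and b sum to at most the crossings of ab, hence
to at most k (`encard_edgesOver_add_le`). Let w have minimum load and let ab be longest over the
antipode of w. The chords wa and wb then have at most k crossings, and one of them is balanced. If
nothing covers the antipode, both loads vanish and the diameter from w works.

Lower bound. In a prism with n columns and m ≥ 6n rows, fewer than 2n separator vertices leave some
column hit at most once, hence connected, and more than two thirds of the rows untouched. These rows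
all hang together through that column, so one side is too large. Listing the rows one after the
other around the circle gives at most 2(n - 1) crossings per edge. With n = k/2 + 1 the two bounds
meet, and a drawing with k' < k crossings per edge would give separations of order k' + 2 < k + 2.
-/

namespace SimpleGraph

section Interlacing

variable {V : Type u} {α : Type*} [LinearOrder α]

/-- With respect to the labelling `q`, one endpoint of `f` lies strictly between the endpoints of
`e` and the other one strictly outside. -/
def Interlaces (q : V → α) (e f : Sym2 V) : Prop :=
  ∃ a b c d, e = s(a, b) ∧ f = s(c, d) ∧ q a < q c ∧ q c < q b ∧ (q d < q a ∨ q b < q d)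

end Interlacing

/-! ### Balanced separations from cyclic labellings -/

section BalancedSeparation

variable {V : Type u} {n : ℕ}

lemma ncard_le_card_of_forall_mem {q : V → ℕ} (hq : Function.Injective q) {S : Set V} {T : Finset ℕ}
    (h : ∀ x ∈ S, q x ∈ T) : S.ncard ≤ T.card := by
  rw [← Set.ncard_coe_finset T]
  exact Set.ncard_le_ncard_of_injOn q (fun x hx => h x hx) hq.injOn T.finite_toSet

/-- A chord that splits the labels evenly and is crossed by at most `k` edges yields a balanced
separation of order at most `k + 2`. -/
lemma exists_balancedSeparation_of_chord [Finite V] (G : SimpleGraph V) {k : ℕ} {q : V → ℕ}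
    (hq : Function.Injective q) (hqn : ∀ v, q v < n) (hn : n = Nat.card V) {u v : V}
    (huv : q u < q v) (h₁ : 3 * q v ≤ 2 * n + 3 + 3 * q u) (h₂ : n + 3 * q u ≤ 3 * q v + 3)
    (hk : {f ∈ G.edgeSet | Interlaces q s(u, v) f}.encard ≤ k) :
    ∃ A B : Set V, G.IsBalancedSeparation A B ∧ (A ∩ B).ncard ≤ k + 2 := by
  classical
  set F := {f ∈ G.edgeSet | Interlaces q s(u, v) f} with hF
  set S : Set V := {c | ∃ d, G.Adj c d ∧ q u < q c ∧ q c < q v ∧ (q d < q u ∨ q v < q d)} with hS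
  have hSk : S.ncard ≤ k := by
    have hFk : F.ncard ≤ k := by
      rw [← Set.Finite.cast_ncard_eq (Set.toFinite F)] at hk
      exact_mod_cast hk
    refine le_trans ?_ hFk
    have hex : ∀ c ∈ S, ∃ d, G.Adj c d ∧ q u < q c ∧ q c < q v ∧ (q d < q u ∨ q v < q d) :=
      fun c hc => hc
    choose! g hg using hex
    -- Each crossing edge has only one end inside the arc, so inner ends inject into crossing edges.
    refine Set.ncard_le_ncard_of_injOn (fun c => s(c, g c)) ?_ ?_ (Set.toFinite F)
    · intro c hc
      exact ⟨(hg c hc).1, u, v, c, g c, rfl, rfl, (hg c hc).2⟩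
    · intro c hc c' hc' h
      rcases Sym2.eq_iff.1 h with h | ⟨h, h'⟩
      · exact h.1
      · have h1 := (hg c hc).2
        have h2 := (hg c' hc').2
        rw [h'] at h1
        omega
  -- The two closed arcs, with the inner ends of the crossing edges added to the outer one. The open
  -- arcs hold q v - q u - 1 and n - (q v - q u) - 1 labels, and `h₁`, `h₂` bound these by 2n/3.
  refine ⟨{x | q u ≤ q x ∧ q x ≤ q v}, {x | q x ≤ q u ∨ q v ≤ q x} ∪ S, ⟨⟨?_, ?_⟩, ?_, ?_⟩, ?_⟩
  · ext x
    simp only [Set.mem_union, Set.mem_ofPred_eq, Set.mem_univ, iff_true]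
    by_cases h : x ∈ S
    · exact Or.inr (Or.inr h)
    · omega
  · rintro a ⟨ha, ha'⟩ b ⟨hb, hb'⟩ hab
    simp only [Set.mem_union, Set.mem_ofPred_eq, not_or, not_and, not_le] at ha ha' hb hb'
    exact ha'.2 ⟨b, hab, ha'.1.1, ha'.1.2, by omega⟩
  · have := ncard_le_card_of_forall_mem hq (T := Finset.Ioo (q u) (q v))
      (S := {x | q u ≤ q x ∧ q x ≤ q v} \ ({x | q x ≤ q u ∨ q v ≤ q x} ∪ S)) (by
        rintro x ⟨hx, hx'⟩
        simp only [Set.mem_union, Set.mem_ofPred_eq, not_or, not_le] at hx hx'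
        exact Finset.mem_Ioo.2 hx'.1)
    rw [Nat.card_Ioo] at this
    omega
  · have := ncard_le_card_of_forall_mem hq (T := Finset.range (q u) ∪ Finset.Ioo (q v) n)
      (S := ({x | q x ≤ q u ∨ q v ≤ q x} ∪ S) \ {x | q u ≤ q x ∧ q x ≤ q v}) (by
        rintro x ⟨hx, hx'⟩
        simp only [Set.mem_ofPred_eq, not_and, not_le] at hx'
        simp only [Finset.mem_union, Finset.mem_range, Finset.mem_Ioo]
        have := hqn x
        omega)
    have h3 := Finset.card_union_le (Finset.range (q u)) (Finset.Ioo (q v) n)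
    rw [Nat.card_Ioo, Finset.card_range] at h3
    have := hqn v
    omega
  · have hsub : {x | q u ≤ q x ∧ q x ≤ q v} ∩ ({x | q x ≤ q u ∨ q v ≤ q x} ∪ S) ⊆ S ∪ {u, v} := by
      rintro x ⟨hx, hx' | hx'⟩
      · right
        simp only [Set.mem_ofPred_eq] at hx hx'
        rcases hx' with h | h
        · exact Or.inl (hq (le_antisymm h hx.1))
        · exact Or.inr (hq (le_antisymm hx.2 h))
      · exact Or.inl hx'
    have h1 := Set.ncard_le_ncard hsub (Set.toFinite _)
    have h2 := Set.ncard_union_le S {u, v}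
    have h3 := Set.ncard_insert_le u {v}
    rw [Set.ncard_singleton] at h3
    omega

/-- The point labelled `x` lies strictly inside the shorter of the two arcs bounded by the labels
`a < b` of `n` cyclically arranged points, provided that this arc has fewer than `n / 3` steps. -/
def InShortArc (n a b x : ℕ) : Prop :=
  a < b ∧ ((3 * b + 4 ≤ n + 3 * a ∧ a < x ∧ x < b) ∨
    (2 * n + 4 + 3 * a ≤ 3 * b ∧ (x < a ∨ b < x)))

/-- The edges of `G` whose short arc contains `x`. -/
def edgesOver (G : SimpleGraph V) (n : ℕ) (q : V → ℕ) (x : V) : Set (Sym2 V) :=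
  {f | ∃ a b, f = s(a, b) ∧ G.Adj a b ∧ InShortArc n (q a) (q b) (q x)}

/-- The edges of `G` are short with respect to `q` if none of them splits the labels evenly. -/
def HasShortEdges (G : SimpleGraph V) (n : ℕ) (q : V → ℕ) : Prop :=
  ∀ a b, G.Adj a b → q a < q b →
    3 * q b + 4 ≤ n + 3 * q a ∨ 2 * n + 4 + 3 * q a ≤ 3 * q b

/-- An edge that interlaces uv has u and v on different sides, so its short side contains one of
them. -/
lemma encard_interlaces_le {G : SimpleGraph V} {q : V → ℕ} (hs : G.HasShortEdges n q) {u v : V}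
    (huv : q u < q v) :
    {f ∈ G.edgeSet | Interlaces q s(u, v) f}.encard ≤
      (G.edgesOver n q u).encard + (G.edgesOver n q v).encard := by
  refine le_trans (Set.encard_le_encard ?_) (Set.encard_union_le _ _)
  rintro f ⟨hf, a, b, c, d, he, rfl, h1, h2, h3⟩
  have hcd : G.Adj c d := hf
  have key : (q u < q c ∧ q c < q v) ∧ (q d < q u ∨ q v < q d) := by
    rcases Sym2.eq_iff.1 he with ⟨rfl, rfl⟩ | ⟨rfl, rfl⟩ <;> omega
  rcases lt_or_ge (q c) (q d) with h | h
  · rcases hs c d hcd h with h' | h'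
    · exact Or.inr ⟨c, d, rfl, hcd, h, by omega⟩
    · exact Or.inl ⟨c, d, rfl, hcd, h, by omega⟩
  · have h : q d < q c := by omega
    rcases hs d c hcd.symm h with h' | h'
    · exact Or.inl ⟨d, c, Sym2.eq_swap, hcd.symm, h, by omega⟩
    · exact Or.inr ⟨d, c, Sym2.eq_swap, hcd.symm, h, by omega⟩

/-- The edges over the two endpoints of an edge that is longest among the edges over `x` are
different, and they all interlace that edge. -/
lemma encard_edgesOver_add_le {G : SimpleGraph V} {q : V → ℕ} (hqn : ∀ v, q v < n)
    {a b x : V} (hx : InShortArc n (q a) (q b) (q x))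
    (hmax : ∀ c d, G.Adj c d → InShortArc n (q c) (q d) (q x) →
      min (q d - q c) (n - (q d - q c)) ≤ min (q b - q a) (n - (q b - q a))) :
    (G.edgesOver n q a).encard + (G.edgesOver n q b).encard ≤
      {f ∈ G.edgeSet | Interlaces q s(a, b) f}.encard := by
  have hA := hqn a
  have hB := hqn b
  have hX := hqn x
  -- Two short arcs cannot cover the circle. Hence an edge over a or b that does not interlace ab
  -- has a short arc containing that of ab, so it lies over x and is strictly longer.
  have hover : ∀ c d, G.Adj c d →
      (InShortArc n (q c) (q d) (q a) ∨ InShortArc n (q c) (q d) (q b)) →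
      ((q a < q c ∧ q c < q b) ∧ (q d < q a ∨ q b < q d)) ∨
      ((q a < q d ∧ q d < q b) ∧ (q c < q a ∨ q b < q c)) := by
    intro c d hcd h
    have hm := hmax c d hcd
    have hC := hqn c
    have hD := hqn d
    unfold InShortArc at *
    by_contra hcon
    have hin : q c < q d ∧ ((3 * q d + 4 ≤ n + 3 * q c ∧ q c < q x ∧ q x < q d) ∨
      (2 * n + 4 + 3 * q c ≤ 3 * q d ∧ (q x < q c ∨ q d < q x))) := by omega
    have hm := hm hin
    omega
  rw [← Set.encard_union_eq]
  · refine Set.encard_le_encard ?_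
    rintro f (⟨c, d, rfl, hcd, h⟩ | ⟨c, d, rfl, hcd, h⟩)
    · rcases hover c d hcd (Or.inl h) with h' | h'
      · exact ⟨hcd, a, b, c, d, rfl, rfl, h'.1.1, h'.1.2, h'.2⟩
      · exact ⟨hcd, a, b, d, c, rfl, Sym2.eq_swap, h'.1.1, h'.1.2, h'.2⟩
    · rcases hover c d hcd (Or.inr h) with h' | h'
      · exact ⟨hcd, a, b, c, d, rfl, rfl, h'.1.1, h'.1.2, h'.2⟩
      · exact ⟨hcd, a, b, d, c, rfl, Sym2.eq_swap, h'.1.1, h'.1.2, h'.2⟩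
  -- An edge interlacing ab separates a from b, so its short arc contains only one of them.
  · rw [Set.disjoint_left]
    rintro f ⟨c, d, rfl, hcd, h⟩ ⟨c', d', he, hcd', h'⟩
    have ho := hover c d hcd (Or.inl h)
    have hcc : c' = c ∧ d' = d := by
      rcases Sym2.eq_iff.1 he with ⟨rfl, rfl⟩ | ⟨rfl, rfl⟩
      · exact ⟨rfl, rfl⟩
      · exact absurd h.1 (by have := h'.1; omega)
    rw [hcc.1, hcc.2] at h'
    unfold InShortArc at *
    omega

theorem exists_balancedSeparation_of_interlaces [Finite V] (G : SimpleGraph V) {k : ℕ} {q : V → ℕ}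
    (hq : Function.Injective q) (hqn : ∀ v, q v < n) (hn : n = Nat.card V)
    (hk : ∀ e ∈ G.edgeSet, {f ∈ G.edgeSet | Interlaces q e f}.encard ≤ k) :
    ∃ A B : Set V, G.IsBalancedSeparation A B ∧ (A ∩ B).ncard ≤ k + 2 := by
  classical
  rcases Nat.lt_or_ge n 3 with h3 | h3
  · refine ⟨Set.univ, Set.univ, ⟨⟨by simp, by simp⟩, by simp, by simp⟩, ?_⟩
    rw [Set.inter_self, Set.ncard_univ]
    omega
  -- An edge that is not short splits the labels evenly and is itself the required chord.
  by_cases hs : G.HasShortEdges n q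
  swap
  · unfold HasShortEdges at hs
    push Not at hs
    obtain ⟨a, b, hab, hlt, h1, h2⟩ := hs
    exact exists_balancedSeparation_of_chord G hq hqn hn hlt (by omega) (by omega)
      (hk s(a, b) hab)
  have hne : Nonempty V := by
    rcases isEmpty_or_nonempty V with h | h
    · rw [Nat.card_of_isEmpty] at hn; omega
    · exact h
  have hsurj : ∀ i < n, ∃ v, q v = i := by
    have hbij : Function.Bijective (fun v => (⟨q v, hqn v⟩ : Fin n)) := by
      rw [Nat.bijective_iff_injective_and_card]
      exact ⟨fun a b h => hq (by simpa using h), by simp [hn]⟩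
    intro i hi
    obtain ⟨v, hv⟩ := hbij.2 ⟨i, hi⟩
    exact ⟨v, by simpa using hv⟩
  obtain ⟨w, hw⟩ := Finite.exists_min (fun v => (G.edgesOver n q v).encard)
  have hwn := hqn w
  have main : ∀ z, (n ≤ 3 * (max (q w) (q z) - min (q w) (q z)) + 3) →
      (3 * (max (q w) (q z) - min (q w) (q z)) ≤ 2 * n + 3) → q w ≠ q z →
      (G.edgesOver n q w).encard + (G.edgesOver n q z).encard ≤ k →
      ∃ A B : Set V, G.IsBalancedSeparation A B ∧ (A ∩ B).ncard ≤ k + 2 := by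
    intro z h1 h2 hne hz
    rcases lt_or_gt_of_ne hne with h | h
    · exact exists_balancedSeparation_of_chord G hq hqn hn h (by omega) (by omega)
        ((encard_interlaces_le hs h).trans hz)
    · exact exists_balancedSeparation_of_chord G hq hqn hn h (by omega) (by omega)
        ((encard_interlaces_le hs h).trans (by rwa [add_comm]))
  -- The antipode of w, up to rounding.
  obtain ⟨x, hx⟩ : ∃ x, q x = q w + n / 2 ∨ q x + n = q w + n / 2 := by
    by_cases h : q w + n / 2 < n
    · obtain ⟨x, hx⟩ := hsurj _ h
      exact ⟨x, Or.inl hx⟩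
    · obtain ⟨x, hx⟩ := hsurj (q w + n / 2 - n) (by omega)
      exact ⟨x, Or.inr (by omega)⟩
  have hxn := hqn x
  let T : Set (V × V) := {p | G.Adj p.1 p.2 ∧ InShortArc n (q p.1) (q p.2) (q x)}
  rcases T.eq_empty_or_nonempty with hT | hT
  · have h0 : G.edgesOver n q x = ∅ := by
      rw [Set.eq_empty_iff_forall_notMem]
      rintro f ⟨a, b, -, hab, h⟩
      exact (hT ▸ (show (a, b) ∈ T from ⟨hab, h⟩) : (a, b) ∈ (∅ : Set (V × V)))
    have h0' : (G.edgesOver n q x).encard = 0 := by rw [h0, Set.encard_empty]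
    have := hw x
    simp only [h0', nonpos_iff_eq_zero] at this
    exact main x (by omega) (by omega) (by omega) (by rw [h0', this]; simp)
  · obtain ⟨⟨a, b⟩, ⟨hab, hE⟩, hmax⟩ := Set.exists_max_image T
      (fun p => min (q p.2 - q p.1) (n - (q p.2 - q p.1))) (Set.toFinite T) hT
    simp only at hab hE hmax
    have hload := (encard_edgesOver_add_le (G := G) hqn hE
      (fun c d hcd h => hmax (c, d) ⟨hcd, h⟩)).trans (hk s(a, b) hab)
    have hA := hqn a
    have hB := hqn b
    have ha : (G.edgesOver n q w).encard + (G.edgesOver n q a).encard ≤ k :=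
      (add_le_add_left (hw b) _).trans (by rwa [add_comm])
    have hb : (G.edgesOver n q w).encard + (G.edgesOver n q b).encard ≤ k :=
      (add_le_add_left (hw a) _).trans hload
    -- The short arc ab has at most (n - 4)/3 steps and contains x, so a or b is within (n - 4)/6
    -- steps of x, hence at least n/3 steps from w both ways round.
    by_cases hwin : (n ≤ 3 * (max (q w) (q a) - min (q w) (q a)) + 3) ∧
      (3 * (max (q w) (q a) - min (q w) (q a)) ≤ 2 * n + 3) ∧ q w ≠ q a
    · exact main a hwin.1 hwin.2.1 hwin.2.2 ha
    · unfold InShortArc at hE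
      exact main b (by omega) (by omega) (by omega) hb

end BalancedSeparation

end SimpleGraph

namespace SimpleGraph

/-! ### Chords of a circle and signed areas -/

section Circle

/-- The point of the circle with centre `c` and radius `r` at angle `x`. -/
noncomputable def circlePoint (c : ℂ) (r x : ℝ) : ℂ :=
  ⟨c.re + r * Real.cos x, c.im + r * Real.sin x⟩

/-- Up to the factor `r ^ 2`, twice the signed area of the triangle with corners at the angles
`x`, `y`, `z` of a circle of radius `r`. -/
noncomputable def circleArea (x y z : ℝ) : ℝ :=
  Real.sin (y - x) + Real.sin (z - y) - Real.sin (z - x)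

lemma circleArea_eq (x y z : ℝ) : circleArea x y z =
    4 * Real.sin ((y - x) / 2) * Real.sin ((z - y) / 2) * Real.sin ((z - x) / 2) := by
  set s := (y - x) / 2 with hs
  set t := (z - y) / 2 with ht
  have h1 : y - x = 2 * s := by rw [hs]; ring
  have h2 : z - y = 2 * t := by rw [ht]; ring
  have h3 : (z - x) / 2 = s + t := by rw [hs, ht]; ring
  have h4 : z - x = 2 * (s + t) := by rw [hs, ht]; ring
  rw [circleArea, h3, h1, h2, h4]
  simp only [Real.sin_two_mul, Real.sin_add, Real.cos_add]
  have e1 := Real.sin_sq_add_cos_sq s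
  have e2 := Real.sin_sq_add_cos_sq t
  have e1' : Real.cos s ^ 2 = 1 - Real.sin s ^ 2 := by linarith
  have e2' : Real.cos t ^ 2 = 1 - Real.sin t ^ 2 := by linarith
  ring_nf
  simp only [e1', e2']
  ring

lemma circleArea_pos {x y z : ℝ} (h₁ : x < y) (h₂ : y < z) (h₃ : z < x + 2 * Real.pi) :
    0 < circleArea x y z := by
  rw [circleArea_eq]
  have a := Real.sin_pos_of_pos_of_lt_pi (x := (y - x) / 2) (by linarith) (by linarith)
  have b := Real.sin_pos_of_pos_of_lt_pi (x := (z - y) / 2) (by linarith) (by linarith)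
  have d := Real.sin_pos_of_pos_of_lt_pi (x := (z - x) / 2) (by linarith) (by linarith)
  positivity

/-- The diagonals of a convex quadrilateral meet. The areas of its four corner triangles are
positive and, normalised, are the weights of the common point on each diagonal. -/
lemma openSegment_circlePoint_inter_nonempty (c : ℂ) (r : ℝ) {x y z w : ℝ} (h₁ : x < y)
    (h₂ : y < z) (h₃ : z < w) (h₄ : w < x + 2 * Real.pi) :
    (openSegment ℝ (circlePoint c r x) (circlePoint c r z) ∩
      openSegment ℝ (circlePoint c r y) (circlePoint c r w)).Nonempty := by
  have a := circleArea_pos (x := y) (y := z) (z := w) h₂ h₃ (by linarith)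
  have b := circleArea_pos (x := x) (y := y) (z := w) h₁ (by linarith) (by linarith)
  have a' := circleArea_pos (x := x) (y := z) (z := w) (by linarith) h₃ (by linarith)
  have b' := circleArea_pos (x := x) (y := y) (z := z) h₁ h₂ (by linarith)
  have hsum : circleArea y z w + circleArea x y w = circleArea x z w + circleArea x y z := by
    unfold circleArea; ring
  set s := circleArea y z w + circleArea x y w with hs
  have hspos : 0 < s := by positivity
  refine ⟨(circleArea y z w / s) • circlePoint c r x + (circleArea x y w / s) • circlePoint c r z,
    ⟨_, _, by positivity, by positivity, by rw [← add_div, ← hs, div_self hspos.ne'], rfl⟩,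
    ⟨circleArea x z w / s, circleArea x y z / s, by positivity, by positivity,
      by rw [← add_div, ← hsum, div_self hspos.ne'], ?_⟩⟩
  have hre : circleArea x z w * (c.re + r * Real.cos y) + circleArea x y z * (c.re + r * Real.cos w)
      = circleArea y z w * (c.re + r * Real.cos x) + circleArea x y w * (c.re + r * Real.cos z) := by
    unfold circleArea; simp only [Real.sin_sub]; ring
  have him : circleArea x z w * (c.im + r * Real.sin y) + circleArea x y z * (c.im + r * Real.sin w)
      = circleArea y z w * (c.im + r * Real.sin x) + circleArea x y w * (c.im + r * Real.sin z) := by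
    unfold circleArea; simp only [Real.sin_sub]; ring
  apply Complex.ext
  · simp only [circlePoint, Complex.add_re, Complex.real_smul, Complex.re_ofReal_mul]
    rw [div_mul_eq_mul_div, div_mul_eq_mul_div, div_mul_eq_mul_div, div_mul_eq_mul_div,
      ← add_div, ← add_div, hre]
  · simp only [circlePoint, Complex.add_im, Complex.real_smul, Complex.im_ofReal_mul]
    rw [div_mul_eq_mul_div, div_mul_eq_mul_div, div_mul_eq_mul_div, div_mul_eq_mul_div,
      ← add_div, ← add_div, him]

/-- Chords with endpoints on the same closed side of each other do not meet in their interiors. -/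
lemma openSegment_circlePoint_disjoint (c : ℂ) {r x y z w : ℝ} (hr : 0 < r)
    (h : 0 ≤ circleArea x y z ∧ 0 < circleArea x y w ∨
      circleArea x y z ≤ 0 ∧ circleArea x y w < 0) :
    Disjoint (openSegment ℝ (circlePoint c r x) (circlePoint c r y))
      (openSegment ℝ (circlePoint c r z) (circlePoint c r w)) := by
  rw [Set.disjoint_left]
  rintro p ⟨s, t, hs, ht, hst, rfl⟩ ⟨s', t', hs', ht', hst', he⟩
  have hre := congrArg Complex.re he
  have him := congrArg Complex.im he
  simp only [circlePoint, Complex.add_re, Complex.add_im, Complex.real_smul,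
    Complex.re_ofReal_mul, Complex.im_ofReal_mul] at hre him
  have hre' : s' * Real.cos z + t' * Real.cos w = s * Real.cos x + t * Real.cos y := by
    have hs1 : s = 1 - t := by linarith
    have hs2 : s' = 1 - t' := by linarith
    refine mul_left_cancel₀ hr.ne' ?_
    rw [hs1, hs2] at hre ⊢
    linarith
  have him' : s' * Real.sin z + t' * Real.sin w = s * Real.sin x + t * Real.sin y := by
    have hs1 : s = 1 - t := by linarith
    have hs2 : s' = 1 - t' := by linarith
    refine mul_left_cancel₀ hr.ne' ?_
    rw [hs1, hs2] at him ⊢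
    linarith
  -- Signed area is affine in the third corner and vanishes on the line through the first two.
  have key : s' * circleArea x y z + t' * circleArea x y w = 0 := by
    have hs1 : s = 1 - t := by linarith
    have : s' * circleArea x y z + t' * circleArea x y w =
        (s' + t') * (Real.sin y * Real.cos x - Real.cos y * Real.sin x)
        + (s' * Real.sin z + t' * Real.sin w) * (Real.cos y - Real.cos x)
        - (s' * Real.cos z + t' * Real.cos w) * (Real.sin y - Real.sin x) := by
      unfold circleArea; simp only [Real.sin_sub]; ring
    rw [this, hre', him', hst', hs1]
    ring
  rcases h with ⟨h1, h2⟩ | ⟨h1, h2⟩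
  · have := mul_nonneg hs'.le h1
    have := mul_pos ht' h2
    linarith
  · have := mul_nonneg hs'.le (neg_nonneg.2 h1)
    have := mul_pos ht' (neg_pos.2 h2)
    linarith

end Circle

/-! ### Geometric crossings versus interlacing of angles -/

section Drawing

variable {V : Type u}

lemma circleArea_rotate (x y z : ℝ) : circleArea x y z = circleArea y z x := by
  unfold circleArea; simp only [Real.sin_sub]; ring

lemma circleArea_swap (x y z : ℝ) : circleArea x y z = - circleArea x z y := by
  unfold circleArea; simp only [Real.sin_sub]; ring

namespace ConvexDrawing

/-- The drawing in which `v` lies on the unit circle at angle `θ v`. -/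
noncomputable def ofAngle (θ : V → ℝ) (hθ : Function.Injective θ)
    (h : ∀ v, θ v ∈ Set.Ico 0 (2 * Real.pi)) : ConvexDrawing V where
  center := 0
  radius := 1
  radius_pos := one_pos
  pos v := circlePoint 0 1 (θ v)
  pos_injective := by
    intro v w hvw
    by_contra hne
    wlog hlt : θ v < θ w generalizing v w
    · exact this hvw.symm (Ne.symm hne)
        (lt_of_le_of_ne (not_lt.1 hlt) fun h' => hne (hθ h'.symm))
    have hv := h v
    have hw := h w
    have hc : Real.cos (θ v) = Real.cos (θ w) := by simpa [circlePoint] using congrArg Complex.re hvw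
    have hs : Real.sin (θ v) = Real.sin (θ w) := by simpa [circlePoint] using congrArg Complex.im hvw
    have h1 : Real.cos (θ w - θ v) = 1 := by
      rw [Real.cos_sub, hc, hs]
      nlinarith [Real.sin_sq_add_cos_sq (θ w)]
    have h2 : Real.cos (θ w - θ v) = 1 - 2 * Real.sin ((θ w - θ v) / 2) ^ 2 := by
      have h3 := Real.cos_two_mul' ((θ w - θ v) / 2)
      have h4 := Real.sin_sq_add_cos_sq ((θ w - θ v) / 2)
      rw [mul_div_cancel₀ _ (two_ne_zero' ℝ)] at h3
      linarith
    have := Real.sin_pos_of_pos_of_lt_pi (x := (θ w - θ v) / 2) (by linarith)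
      (by linarith [hv.1, hw.2])
    nlinarith
  pos_mem_circle v := by
    rw [mem_sphere_zero_iff_norm, ← sq_eq_sq₀ (norm_nonneg _) zero_le_one, Complex.sq_norm,
      Complex.normSq_apply]
    have := Real.sin_sq_add_cos_sq (θ v)
    simp only [circlePoint, Complex.zero_re, Complex.zero_im]
    linarith

/-- The sign of `circleArea` tells on which side of ab a vertex lies. Without interlacing, c and d
lie on one closed side, at least one of them strictly unless both edges coincide. -/
lemma interlaces_of_crosses_ofAngle {θ : V → ℝ} {hθ : Function.Injective θ}
    {h : ∀ v, θ v ∈ Set.Ico 0 (2 * Real.pi)} {a b c d : V} (hab : θ a < θ b) (hcd : c ≠ d)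
    (hX : (ofAngle θ hθ h).Crosses s(a, b) s(c, d)) : Interlaces θ s(a, b) s(c, d) := by
  by_contra hcon
  have hc1 : ¬ (θ a < θ c ∧ θ c < θ b ∧ (θ d < θ a ∨ θ b < θ d)) :=
    fun h' => hcon ⟨a, b, c, d, rfl, rfl, h'⟩
  have hc2 : ¬ (θ a < θ d ∧ θ d < θ b ∧ (θ c < θ a ∨ θ b < θ c)) :=
    fun h' => hcon ⟨a, b, d, c, rfl, Sym2.eq_swap, h'⟩
  obtain ⟨hne, hX⟩ := hX
  have hin : ∀ v, θ a < θ v → θ v < θ b → circleArea (θ a) (θ b) (θ v) < 0 := by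
    intro v h1 h2
    rw [circleArea_swap, neg_lt_zero]
    exact circleArea_pos h1 h2 (by linarith [(h a).1, (h b).2])
  have hout : ∀ v, θ v < θ a ∨ θ b < θ v → 0 < circleArea (θ a) (θ b) (θ v) := by
    rintro v (h1 | h1)
    · rw [circleArea_rotate, circleArea_rotate]
      exact circleArea_pos h1 hab (by linarith [(h v).1, (h b).2])
    · exact circleArea_pos hab h1 (by linarith [(h a).1, (h v).2])
  have hzero : ∀ v, v = a ∨ v = b → circleArea (θ a) (θ b) (θ v) = 0 := by
    rintro v (rfl | rfl) <;> simp only [circleArea, Real.sin_sub] <;> ring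
  have hcases : ∀ v, (v = a ∨ v = b) ∨ (θ a < θ v ∧ θ v < θ b) ∨ (θ v < θ a ∨ θ b < θ v) := by
    intro v
    rcases lt_trichotomy (θ v) (θ a) with h1 | h1 | h1
    · exact Or.inr (Or.inr (Or.inl h1))
    · exact Or.inl (Or.inl (hθ h1))
    · rcases lt_trichotomy (θ v) (θ b) with h2 | h2 | h2
      · exact Or.inr (Or.inl ⟨h1, h2⟩)
      · exact Or.inl (Or.inr (hθ h2))
      · exact Or.inr (Or.inr (Or.inr h2))
  have hX' : (openSegment ℝ (circlePoint 0 1 (θ a)) (circlePoint 0 1 (θ b)) ∩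
      openSegment ℝ (circlePoint 0 1 (θ c)) (circlePoint 0 1 (θ d))).Nonempty := hX
  have hX'' : (openSegment ℝ (circlePoint 0 1 (θ a)) (circlePoint 0 1 (θ b)) ∩
      openSegment ℝ (circlePoint 0 1 (θ d)) (circlePoint 0 1 (θ c))).Nonempty := by
    rwa [openSegment_symm ℝ (circlePoint 0 1 (θ d))]
  have D1 := fun h' => Set.not_disjoint_iff_nonempty_inter.2 hX'
    (openSegment_circlePoint_disjoint 0 one_pos h')
  have D2 := fun h' => Set.not_disjoint_iff_nonempty_inter.2 hX''
    (openSegment_circlePoint_disjoint 0 one_pos h')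
  rcases hcases c with h1 | h1 | h1 <;> rcases hcases d with h2 | h2 | h2
  · apply hne
    rcases h1 with rfl | rfl <;> rcases h2 with rfl | rfl
    · exact absurd rfl hcd
    · rfl
    · exact Sym2.eq_swap
    · exact absurd rfl hcd
  · exact D1 (Or.inr ⟨(hzero c h1).le, hin d h2.1 h2.2⟩)
  · exact D1 (Or.inl ⟨(hzero c h1).ge, hout d h2⟩)
  · exact D2 (Or.inr ⟨(hzero d h2).le, hin c h1.1 h1.2⟩)
  · exact D1 (Or.inr ⟨(hin c h1.1 h1.2).le, hin d h2.1 h2.2⟩)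
  · exact hc1 ⟨h1.1, h1.2, h2⟩
  · exact D2 (Or.inl ⟨(hzero d h2).ge, hout c h1⟩)
  · exact hc2 ⟨h2.1, h2.2, h1⟩
  · exact D1 (Or.inl ⟨(hout c h1).le, hout d h2⟩)

/-- The angle of a vertex in a drawing. -/
noncomputable def angle (D : ConvexDrawing V) (v : V) : ℝ := (D.pos v - D.center).arg

lemma pos_eq_circlePoint (D : ConvexDrawing V) (v : V) :
    D.pos v = circlePoint D.center D.radius (D.angle v) := by
  have h := D.pos_mem_circle v
  rw [mem_sphere_iff_norm] at h
  apply Complex.ext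
  · simp only [circlePoint, angle]
    rw [← h, Complex.norm_mul_cos_arg, Complex.sub_re]; ring
  · simp only [circlePoint, angle]
    rw [← h, Complex.norm_mul_sin_arg, Complex.sub_im]; ring

lemma angle_injective (D : ConvexDrawing V) : Function.Injective D.angle := by
  intro v w h
  apply D.pos_injective
  rw [pos_eq_circlePoint, pos_eq_circlePoint, h]

lemma crosses_of_interlaces (D : ConvexDrawing V) {e f : Sym2 V}
    (h : Interlaces D.angle e f) : D.Crosses e f := by
  obtain ⟨a, b, c, d, rfl, rfl, h1, h2, h3⟩ := h
  have hpi : ∀ v w, D.angle v < D.angle w + 2 * Real.pi := by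
    intro v w
    have := Complex.arg_le_pi (D.pos v - D.center)
    have := Complex.neg_pi_lt_arg (D.pos w - D.center)
    simp only [angle]
    linarith
  refine ⟨?_, ?_⟩
  · intro he
    rcases Sym2.eq_iff.1 he with ⟨rfl, rfl⟩ | ⟨rfl, rfl⟩
    · exact lt_irrefl _ h1
    · exact lt_irrefl _ h2
  · change (openSegment ℝ (D.pos a) (D.pos b) ∩ openSegment ℝ (D.pos c) (D.pos d)).Nonempty
    simp only [pos_eq_circlePoint]
    rcases h3 with h3 | h3
    · rw [Set.inter_comm, openSegment_symm ℝ (circlePoint _ _ (D.angle c))]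
      exact openSegment_circlePoint_inter_nonempty _ _ h3 h1 h2 (hpi _ _)
    · exact openSegment_circlePoint_inter_nonempty _ _ h1 h2 h3 (hpi _ _)

end ConvexDrawing

theorem IsOuterKPlanar.exists_balancedSeparation [Finite V] {G : SimpleGraph V} {k : ℕ}
    (hG : G.IsOuterKPlanar k) :
    ∃ A B : Set V, G.IsBalancedSeparation A B ∧ (A ∩ B).ncard ≤ k + 2 := by
  obtain ⟨D, hD⟩ := hG
  have := Fintype.ofFinite V
  -- Only the order of the angles matters, so the rank by angle serves as label.
  let _ : LinearOrder V := LinearOrder.lift' D.angle D.angle_injective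
  let o := Fintype.orderIsoFinOfCardEq V rfl
  have hlt : ∀ a b : V, (o.symm a : ℕ) < o.symm b ↔ D.angle a < D.angle b := by
    intro a b
    rw [← Fin.lt_def, o.symm.lt_iff_lt]
    rfl
  refine exists_balancedSeparation_of_interlaces G (n := Fintype.card V)
    (q := fun v => (o.symm v : ℕ)) (fun a b h => o.symm.injective (Fin.ext h))
    (fun v => (o.symm v).2) (by simp) ?_
  intro e he
  refine le_trans (Set.encard_le_encard ?_) (hD e he)
  rintro f ⟨hf, a, b, c, d, rfl, rfl, h⟩
  simp only [hlt] at h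
  exact ⟨hf, D.crosses_of_interlaces ⟨a, b, c, d, rfl, rfl, h⟩⟩

lemma IsOuterKPlanar.coe_subgraph {G : SimpleGraph V} {k : ℕ} (hG : G.IsOuterKPlanar k)
    (H : G.Subgraph) : H.coe.IsOuterKPlanar k := by
  obtain ⟨D, hD⟩ := hG
  refine ⟨⟨D.center, D.radius, D.radius_pos, fun v => D.pos v,
    fun v w h => Subtype.ext (D.pos_injective h), fun v => D.pos_mem_circle v⟩, ?_⟩
  intro e he
  have hmem : ∀ f ∈ H.coe.edgeSet, Sym2.map Subtype.val f ∈ G.edgeSet := by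
    intro f
    induction f with | _ a b => exact fun h => H.adj_sub h
  refine le_trans ?_ (hD _ (hmem e he))
  have hinj := Sym2.map.injective (Subtype.val_injective (p := fun v => v ∈ H.verts))
  rw [← hinj.encard_image]
  refine Set.encard_le_encard ?_
  rintro _ ⟨f, ⟨hf, hne, hX⟩, rfl⟩
  refine ⟨hmem f hf, hinj.ne hne, ?_⟩
  induction e with | _ a b => induction f with | _ c d => exact hX

theorem IsOuterKPlanar.hasSubgraphSeparations [Finite V] {G : SimpleGraph V} {k : ℕ}
    (hG : G.IsOuterKPlanar k) : G.HasSubgraphSeparations (k + 2) :=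
  fun H => (hG.coe_subgraph H).exists_balancedSeparation

theorem IsOuterKPlanar.separationNumber_le [Finite V] {G : SimpleGraph V} {k : ℕ}
    (hG : G.IsOuterKPlanar k) : G.separationNumber ≤ (k : ℕ∞) + 2 :=
  (iInf₂_le (k + 2) hG.hasSubgraphSeparations).trans (by push_cast; rfl)

end Drawing

end SimpleGraph

namespace SimpleGraph

/-! ### Separations of the stacked prism -/

section LowerBound

/-- A predicate that is invariant under the adjacent steps between `a` and `b` agrees at `a` and
`b`. -/
lemma iff_of_forall_succ_iff {Q : ℕ → Prop} {a b : ℕ} (hab : a ≤ b)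
    (h : ∀ t, a ≤ t → t < b → (Q t ↔ Q (t + 1))) : Q a ↔ Q b := by
  induction b, hab using Nat.le_induction with
  | base => rfl
  | succ b hb ih =>
    exact (ih fun t h1 h2 => h t h1 (h2.trans (Nat.lt_succ_self b))).trans
      (h b hb (Nat.lt_succ_self b))

lemma cycleGraph_adj_succ {m i : ℕ} (h : i + 1 < m) :
    (cycleGraph m).Adj ⟨i, by omega⟩ ⟨i + 1, h⟩ :=
  pathGraph_le_cycleGraph (pathGraph_adj.2 (Or.inl rfl))

lemma cycleGraph_adj_zero_last {m : ℕ} (h : 2 ≤ m) :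
    (cycleGraph m).Adj ⟨0, by omega⟩ ⟨m - 1, by omega⟩ := by
  rw [cycleGraph_adj']
  left
  rw [Fin.sub_def]
  simp only
  rw [Nat.mod_eq_of_lt] <;> omega

lemma eq_or_of_cycleGraph_adj {m : ℕ} {u v : Fin m} (h : (cycleGraph m).Adj u v) :
    (u.val + 1 = v.val ∨ v.val + 1 = u.val) ∨ (u.val + 1 = v.val + m ∨ v.val + 1 = u.val + m) := by
  have hu := u.2
  have hv := v.2
  have key : ∀ a b : Fin m, (a - b).val = 1 → b.val + 1 = a.val ∨ b.val + 1 = a.val + m := by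
    intro a b hab
    have ha := a.2
    have hb := b.2
    rw [Fin.sub_def] at hab
    simp only at hab
    rcases le_or_gt b.val a.val with h | h
    · rw [show m - b.val + a.val = (a.val - b.val) + m by omega, Nat.add_mod_right,
        Nat.mod_eq_of_lt (by omega)] at hab
      omega
    · rw [Nat.mod_eq_of_lt (by omega)] at hab
      omega
  rw [cycleGraph_adj'] at h
  rcases h with h | h
  · have := key u v h; omega
  · have := key v u h; omega

/-- On a cycle with at most one exceptional vertex, a predicate that agrees at adjacent
non-exceptional vertices is constant off the exceptional vertex. -/
lemma iff_of_cycleGraph {m : ℕ} {P : Fin m → Prop} {S : Set (Fin m)} (hS : S.Subsingleton)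
    (h : ∀ i i', (cycleGraph m).Adj i i' → i ∉ S → i' ∉ S → (P i ↔ P i')) {i i' : Fin m}
    (hi : i ∉ S) (hi' : i' ∉ S) : P i ↔ P i' := by
  wlog hle : i ≤ i' generalizing i i'
  · exact (this hi' hi (le_of_not_ge hle)).symm
  have seg : ∀ (a b : Fin m), a ≤ b → (∀ c, a ≤ c → c ≤ b → c ∉ S) → (P a ↔ P b) := by
    intro a b hab hc
    have := iff_of_forall_succ_iff (Q := fun t => ∃ ht : t < m, P ⟨t, ht⟩) (a := a.val)
      (b := b.val) hab (fun t h1 h2 => by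
        have hb := b.2
        have := h ⟨t, by omega⟩ ⟨t + 1, by omega⟩ (cycleGraph_adj_succ (by omega))
          (hc _ h1 (show t ≤ b.val by omega)) (hc _ (show a.val ≤ t + 1 by omega) h2)
        constructor
        · rintro ⟨_, h'⟩; exact ⟨_, this.1 h'⟩
        · rintro ⟨_, h'⟩; exact ⟨_, this.2 h'⟩)
    constructor
    · intro h'; exact (this.1 ⟨a.2, h'⟩).2
    · intro h'; exact (this.2 ⟨b.2, h'⟩).2
  by_cases hc : ∀ c, i ≤ c → c ≤ i' → c ∉ S
  · exact seg i i' hle hc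
  push Not at hc
  obtain ⟨c, h1, h2, hcS⟩ := hc
  have h1' : i < c := lt_of_le_of_ne h1 (by rintro rfl; exact hi hcS)
  have h2' : c < i' := lt_of_le_of_ne h2 (by rintro rfl; exact hi' hcS)
  have hout : ∀ d, d < c ∨ c < d → d ∉ S := by
    intro d hd hdS
    have := hS hdS hcS
    subst this
    simp at hd
  -- The exceptional vertex blocks the direct path, so go the other way round, through the edge
  -- between 0 and m - 1.
  have hm : 2 ≤ m := by have := i'.2; have : i.val < c.val := h1'; have : c.val < i'.val := h2'; omega
  have e1 := seg ⟨0, by omega⟩ i (Nat.zero_le _) (fun d _ hd => hout d (Or.inl (hd.trans_lt h1')))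
  have e2 := seg i' ⟨m - 1, by omega⟩ (show i'.val ≤ m - 1 by omega)
    (fun d hd _ => hout d (Or.inr (h2'.trans_le hd)))
  have e3 := h _ _ (cycleGraph_adj_zero_last hm)
    (hout _ (Or.inl (lt_of_le_of_lt (Nat.zero_le i.val) h1')))
    (hout _ (Or.inr (lt_of_lt_of_le h2' (show i'.val ≤ m - 1 by omega))))
  exact e1.symm.trans (e3.trans e2.symm)

theorem two_mul_le_ncard_of_isBalancedSeparation_stackedPrism {m n : ℕ} (hn : 1 ≤ n)
    (hm : 6 * n ≤ m) {A B : Set (Fin m × Fin n)}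
    (h : (stackedPrism m n).IsBalancedSeparation A B) : 2 * n ≤ (A ∩ B).ncard := by
  classical
  by_contra! hlt
  obtain ⟨⟨hAB, hsep⟩, hA, hB⟩ := h
  have hadj : ∀ x y, (stackedPrism m n).Adj x y → x ∉ A ∩ B → y ∉ A ∩ B →
      (x ∈ A \ B ↔ y ∈ A \ B) := by
    intro x y hxy hx hy
    have hx' : x ∈ A ∪ B := hAB ▸ Set.mem_univ x
    have hy' : y ∈ A ∪ B := hAB ▸ Set.mem_univ y
    have s1 := fun h1 h2 => hsep x h1 y h2 hxy
    have s2 := fun h1 h2 => hsep y h1 x h2 hxy.symm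
    simp only [Set.mem_inter_iff, Set.mem_union, Set.mem_sdiff] at hx hy hx' hy' s1 s2 ⊢
    tauto
  set S : Finset (Fin m × Fin n) := (A ∩ B).toFinset with hS
  have hSc : S.card < 2 * n := by rwa [← Set.ncard_eq_toFinset_card']
  have hSm : ∀ x, x ∈ S ↔ x ∈ A ∩ B := fun x => Set.mem_toFinset
  obtain ⟨j, hj⟩ : ∃ j : Fin n, (S.filter (fun x => x.2 = j)).card ≤ 1 := by
    by_contra! hcon
    have h1 := Finset.card_eq_sum_card_fiberwise (f := Prod.snd) (s := S)
      (t := (Finset.univ : Finset (Fin n))) (fun _ _ => Finset.mem_coe.2 (Finset.mem_univ _))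
    have h2 : ∑ _j : Fin n, 2 ≤ ∑ j : Fin n, (S.filter (fun x => x.2 = j)).card :=
      Finset.sum_le_sum fun j _ => hcon j
    simp only [Finset.sum_const, Finset.card_univ, Fintype.card_fin, smul_eq_mul] at h2
    omega
  have hcol : ∀ i i' : Fin m, (i, j) ∉ A ∩ B → (i', j) ∉ A ∩ B →
      ((i, j) ∈ A \ B ↔ (i', j) ∈ A \ B) := by
    intro i i' hi hi'
    refine iff_of_cycleGraph (P := fun i => (i, j) ∈ A \ B) (S := {i | (i, j) ∈ A ∩ B}) ?_ ?_ hi hi'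
    · intro a ha b hb
      have := Finset.card_le_one.1 hj (a, j) (by simpa [hSm] using ha) (b, j)
        (by simpa [hSm] using hb)
      exact (Prod.ext_iff.1 this).1
    · intro a b hab ha hb
      exact hadj _ _ (Or.inl ⟨hab, rfl⟩) ha hb
  set R : Finset (Fin m) := Finset.univ \ S.image Prod.fst with hR
  -- With 6n ≤ m this gives more than 2m/3 rows free of the separator.
  have hRc : m < R.card + 2 * n := by
    have h1 := Finset.le_card_sdiff (S.image Prod.fst) (Finset.univ : Finset (Fin m))
    have h2 := Finset.card_image_le (s := S) (f := Prod.fst)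
    rw [Finset.card_univ, Fintype.card_fin, ← hR] at h1
    omega
  have hclean : ∀ i ∈ R, ∀ j', (i, j') ∉ A ∩ B := by
    intro i hi j' hij
    rw [hR, Finset.mem_sdiff] at hi
    exact hi.2 (Finset.mem_image.2 ⟨(i, j'), (hSm _).2 hij, rfl⟩)
  have hrow : ∀ i ∈ R, ∀ a b : Fin n, a ≤ b → ((i, a) ∈ A \ B ↔ (i, b) ∈ A \ B) := by
    intro i hi a b hab
    have := iff_of_forall_succ_iff (Q := fun t => ∃ ht : t < n, (i, (⟨t, ht⟩ : Fin n)) ∈ A \ B)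
      (a := a.val) (b := b.val) hab (fun t h1 h2 => by
        have hb := b.2
        have := hadj (i, ⟨t, by omega⟩) (i, ⟨t + 1, by omega⟩)
          (Or.inr ⟨pathGraph_adj.2 (Or.inl rfl), rfl⟩) (hclean i hi _) (hclean i hi _)
        constructor
        · rintro ⟨_, h'⟩; exact ⟨_, this.1 h'⟩
        · rintro ⟨_, h'⟩; exact ⟨_, this.2 h'⟩)
    constructor
    · intro h'; exact (this.1 ⟨a.2, h'⟩).2
    · intro h'; exact (this.2 ⟨b.2, h'⟩).2
  have hrow' : ∀ i ∈ R, ∀ a, ((i, a) ∈ A \ B ↔ (i, j) ∈ A \ B) := by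
    intro i hi a
    rcases le_total a j with h | h
    · exact hrow i hi a j h
    · exact (hrow i hi j a h).symm
  have hcard : ∀ T : Set (Fin m × Fin n), (∀ i ∈ R, ∀ a, (i, a) ∈ T) → 3 * T.ncard ≤ 2 * Nat.card
      (Fin m × Fin n) → False := by
    intro T hT hTc
    have h1 : (R ×ˢ (Finset.univ : Finset (Fin n))).card ≤ T.ncard := by
      rw [← Set.ncard_coe_finset]
      refine Set.ncard_le_ncard ?_ (Set.toFinite T)
      rintro ⟨i, a⟩ hia
      exact hT i (Finset.mem_product.1 (Finset.mem_coe.1 hia)).1 a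
    rw [Finset.card_product, Finset.card_univ, Fintype.card_fin] at h1
    simp only [Nat.card_eq_fintype_card, Fintype.card_prod, Fintype.card_fin] at hTc
    have h2 : 3 * R.card * n ≤ 2 * m * n := by nlinarith
    have := Nat.le_of_mul_le_mul_right h2 hn
    omega
  obtain ⟨i₀, hi₀⟩ : R.Nonempty := by
    rw [← Finset.card_pos]; omega
  by_cases hP : (i₀, j) ∈ A \ B
  · refine hcard (A \ B) (fun i hi a => ?_) hA
    rw [hrow' i hi a, hcol i i₀ (hclean i hi j) (hclean i₀ hi₀ j)]
    exact hP
  · refine hcard (B \ A) (fun i hi a => ?_) hB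
    have h1 : (i, a) ∉ A \ B := by
      rw [hrow' i hi a, hcol i i₀ (hclean i hi j) (hclean i₀ hi₀ j)]
      exact hP
    have h2 := hclean i hi a
    have h3 : (i, a) ∈ A ∪ B := hAB ▸ Set.mem_univ _
    rcases h3 with h3 | h3
    · exact absurd ⟨h3, fun h4 => h2 ⟨h3, h4⟩⟩ h1
    · exact ⟨h3, fun h4 => h2 ⟨h4, h3⟩⟩

lemma HasSubgraphSeparations.exists_balancedSeparation {V : Type u} {G : SimpleGraph V} {s : ℕ}
    (h : G.HasSubgraphSeparations s) :
    ∃ A B : Set V, G.IsBalancedSeparation A B ∧ (A ∩ B).ncard ≤ s := by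
  obtain ⟨A, B, ⟨⟨hAB, hsep⟩, hA, hB⟩, hs⟩ := h ⊤
  have hinj : Function.Injective (Subtype.val : (⊤ : G.Subgraph).verts → V) :=
    Subtype.val_injective
  have hc : Nat.card (⊤ : G.Subgraph).verts = Nat.card V := by
    rw [Subgraph.verts_top]; exact Nat.card_congr (Equiv.Set.univ V)
  refine ⟨Subtype.val '' A, Subtype.val '' B, ⟨⟨?_, ?_⟩, ?_, ?_⟩, ?_⟩
  · rw [← Set.image_union, hAB, Set.image_univ, Subtype.range_coe, Subgraph.verts_top]
  · rw [← Set.image_sdiff hinj, ← Set.image_sdiff hinj]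
    rintro _ ⟨a, ha, rfl⟩ _ ⟨b, hb, rfl⟩ hab
    exact hsep a ha b hb hab
  · rwa [← Set.image_sdiff hinj, Set.ncard_image_of_injective _ hinj, ← hc]
  · rwa [← Set.image_sdiff hinj, Set.ncard_image_of_injective _ hinj, ← hc]
  · rwa [← Set.image_inter hinj, Set.ncard_image_of_injective _ hinj]

end LowerBound

/-! ### A convex drawing of the stacked prism -/

section PrismDrawing

variable {m n : ℕ}

/-- The rows of the stacked prism listed one after the other. -/
def prismLabel (v : Fin m × Fin n) : ℕ := v.1 * n + v.2

lemma prismLabel_lt (v : Fin m × Fin n) : prismLabel v < m * n := by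
  have h1 := v.1.2
  have h2 := v.2.2
  unfold prismLabel
  nlinarith

lemma prismLabel_injective : Function.Injective (prismLabel : Fin m × Fin n → ℕ) := by
  intro v w h
  apply finProdFinEquiv.injective
  apply Fin.ext
  simp only [finProdFinEquiv_apply_val]
  unfold prismLabel at h
  linarith

/-- The vertices `v`, `w` are consecutive in their column, cyclically. -/
def ColumnStep (v w : Fin m × Fin n) : Prop :=
  prismLabel v + n = prismLabel w ∨ prismLabel v + n = prismLabel w + m * n

lemma exists_step_of_mem_edgeSet {e : Sym2 (Fin m × Fin n)}
    (he : e ∈ (stackedPrism m n).edgeSet) : ∃ v w, e = s(v, w) ∧ v ≠ w ∧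
      (prismLabel v + 1 = prismLabel w ∨ ColumnStep v w) := by
  induction e with | _ v w =>
  have hne : v ≠ w := SimpleGraph.Adj.ne ((mem_edgeSet _).1 he)
  obtain ⟨i, a⟩ := v
  obtain ⟨j, b⟩ := w
  rcases he with ⟨h, h'⟩ | ⟨h, h'⟩
  · simp only at h h'
    subst h'
    unfold ColumnStep prismLabel
    rcases eq_or_of_cycleGraph_adj h with (h | h) | (h | h)
    · exact ⟨_, _, rfl, hne, Or.inr (Or.inl (by simp only [← h]; ring))⟩
    · exact ⟨_, _, Sym2.eq_swap, hne.symm, Or.inr (Or.inl (by simp only [← h]; ring))⟩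
    · refine ⟨_, _, rfl, hne, Or.inr (Or.inr ?_)⟩
      have := congrArg (· * n) h
      simp only [add_mul, one_mul] at this
      simp only
      omega
    · refine ⟨_, _, Sym2.eq_swap, hne.symm, Or.inr (Or.inr ?_)⟩
      have := congrArg (· * n) h
      simp only [add_mul, one_mul] at this
      simp only
      omega
  · simp only at h h'
    subst h'
    unfold prismLabel
    rcases pathGraph_adj.1 h with h | h
    · exact ⟨_, _, rfl, hne, Or.inl (by simp only; omega)⟩
    · exact ⟨_, _, Sym2.eq_swap, hne.symm, Or.inl (by simp only; omega)⟩

lemma interlaces_mk {V α : Type*} [LinearOrder α] {q : V → α} {a b c d : V}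
    (h : Interlaces q s(a, b) s(c, d)) :
    ((q a < q c ∧ q c < q b ∨ q b < q c ∧ q c < q a) ∧
      (q d < q a ∧ q d < q b ∨ q a < q d ∧ q b < q d)) ∨
    ((q a < q d ∧ q d < q b ∨ q b < q d ∧ q d < q a) ∧
      (q c < q a ∧ q c < q b ∨ q a < q c ∧ q b < q c)) := by
  obtain ⟨a', b', c', d', he, hf, h1, h2, h3⟩ := h
  have h12 := h1.trans h2
  rcases Sym2.eq_iff.1 he with ⟨rfl, rfl⟩ | ⟨rfl, rfl⟩ <;>
    rcases Sym2.eq_iff.1 hf with ⟨rfl, rfl⟩ | ⟨rfl, rfl⟩ <;>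
    rcases h3 with h3 | h3 <;>
    first
    | simp [h1, h2, h3, h3.trans h12]
    | simp [h1, h2, h3, h12.trans h3]

/-- Row edges join consecutive labels and cross nothing. Column edges are the cyclic chords from p
to p + n, and two of them interlace only if their starting points differ by t with 0 < |t| < n. This
leaves 2(n - 1) values of t, each of which determines the other edge. -/
lemma encard_interlaces_stackedPrism_le (hn : 1 ≤ n) (hm : 3 ≤ m) {e : Sym2 (Fin m × Fin n)}
    (he : e ∈ (stackedPrism m n).edgeSet) :
    {f ∈ (stackedPrism m n).edgeSet | Interlaces prismLabel e f}.encard ≤ (2 * (n - 1) : ℕ) := by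
  have hN : 3 * n ≤ m * n := Nat.mul_le_mul_right n hm
  obtain ⟨x, y, rfl, hxy, hstep⟩ := exists_step_of_mem_edgeSet he
  have hx := prismLabel_lt x
  have hy := prismLabel_lt y
  set N := m * n with hNdef
  let T : Finset ℤ := (Finset.Ioo (-(n : ℤ)) n).erase 0
  have hT : T.card = 2 * (n - 1) := by
    rw [Finset.card_erase_of_mem (by simp; omega), Int.card_Ioo]
    omega
  set F := {f ∈ (stackedPrism m n).edgeSet | Interlaces prismLabel s(x, y) f}
  have hF : ∀ f ∈ F, ∃ t : ℤ, t ∈ T ∧ ∃ z w, f = s(z, w) ∧ ColumnStep z w ∧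
      ((prismLabel z : ℤ) = prismLabel x + t ∨ (prismLabel z : ℤ) + N = prismLabel x + t ∨
        (prismLabel z : ℤ) = prismLabel x + t + N) := by
    rintro f ⟨hf, hX⟩
    obtain ⟨z, w, rfl, hzw, hstep'⟩ := exists_step_of_mem_edgeSet hf
    have hz := prismLabel_lt z
    have hw := prismLabel_lt w
    have hX := interlaces_mk hX
    have hcol : ColumnStep z w := by
      refine hstep'.resolve_left ?_
      intro h
      omega
    have hcol' : ColumnStep x y := by
      refine hstep.resolve_left ?_
      intro h
      omega
    have hmem : ∀ t : ℤ, t ∈ T ↔ t ≠ 0 ∧ -(n : ℤ) < t ∧ t < n := by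
      intro t
      simp only [T, Finset.mem_erase, Finset.mem_Ioo]
    have hcol2 := hcol
    unfold ColumnStep at hcol hcol'
    rw [← hNdef] at hcol hcol' hz hw
    have key : ∃ t : ℤ, (t ≠ 0 ∧ -(n : ℤ) < t ∧ t < n) ∧
      ((prismLabel z : ℤ) = prismLabel x + t ∨ (prismLabel z : ℤ) + N = prismLabel x + t ∨
        (prismLabel z : ℤ) = prismLabel x + t + N) := by
      by_cases h1 : -(n : ℤ) < (prismLabel z : ℤ) - prismLabel x ∧
          (prismLabel z : ℤ) - prismLabel x < n
      · exact ⟨(prismLabel z : ℤ) - prismLabel x, by omega, Or.inl (by omega)⟩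
      by_cases h2 : (prismLabel z : ℤ) < prismLabel x
      · exact ⟨(prismLabel z : ℤ) - prismLabel x + N, by omega, Or.inr (Or.inl (by omega))⟩
      · exact ⟨(prismLabel z : ℤ) - prismLabel x - N, by omega, Or.inr (Or.inr (by omega))⟩
    obtain ⟨t, ht, ht'⟩ := key
    exact ⟨t, (hmem t).2 ht, z, w, rfl, hcol2, ht'⟩
  choose! τ hτ using hF
  rw [← hT, ← Set.encard_coe_eq_coe_finsetCard]
  refine Set.encard_le_encard_of_injOn (f := τ) (fun f hf => (hτ f hf).1) ?_
  intro f hf f' hf' hff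
  obtain ⟨ht, z, w, rfl, hzw, hz⟩ := hτ f hf
  obtain ⟨-, z', w', rfl, hzw', hz'⟩ := hτ f' hf'
  rw [← hff] at hz'
  simp only [T, Finset.mem_erase, Finset.mem_Ioo] at ht
  have h1 := prismLabel_lt z
  have h2 := prismLabel_lt w
  have h3 := prismLabel_lt z'
  have h4 := prismLabel_lt w'
  unfold ColumnStep at hzw hzw'
  rw [← hNdef] at h1 h2 h3 h4 hzw hzw'
  have e1 : prismLabel z = prismLabel z' := by omega
  have e2 : prismLabel w = prismLabel w' := by omega
  rw [prismLabel_injective e1, prismLabel_injective e2]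

lemma Interlaces.of_lt_iff {V α β : Type*} [LinearOrder α] [LinearOrder β] {q : V → α}
    {r : V → β} (h : ∀ a b, q a < q b ↔ r a < r b) {e f : Sym2 V} (he : Interlaces q e f) :
    Interlaces r e f := by
  obtain ⟨a, b, c, d, rfl, rfl, h'⟩ := he
  simp only [h] at h'
  exact ⟨a, b, c, d, rfl, rfl, h'⟩

theorem isOuterKPlanar_stackedPrism (hn : 1 ≤ n) (hm : 3 ≤ m) :
    (stackedPrism m n).IsOuterKPlanar (2 * (n - 1)) := by
  have hN : 0 < ((m * n : ℕ) : ℝ) := by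
    have : 0 < m * n := Nat.mul_pos (by omega) hn
    exact_mod_cast this
  have hc : 0 < 2 * Real.pi / ((m * n : ℕ) : ℝ) := by positivity
  let θ : Fin m × Fin n → ℝ := fun v => (2 * Real.pi / ((m * n : ℕ) : ℝ)) * prismLabel v
  have hlt : ∀ a b, θ a < θ b ↔ prismLabel a < prismLabel b := by
    intro a b
    simp only [θ]
    rw [mul_lt_mul_iff_right₀ hc, Nat.cast_lt]
  have hθ : Function.Injective θ := fun a b h =>
    prismLabel_injective (Nat.cast_injective (mul_left_cancel₀ hc.ne' h))
  have hI : ∀ v, θ v ∈ Set.Ico 0 (2 * Real.pi) := by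
    intro v
    refine ⟨by positivity, ?_⟩
    have h1 : (prismLabel v : ℝ) < ((m * n : ℕ) : ℝ) := by exact_mod_cast prismLabel_lt v
    calc θ v < (2 * Real.pi / ((m * n : ℕ) : ℝ)) * ((m * n : ℕ) : ℝ) :=
          mul_lt_mul_of_pos_left h1 hc
      _ = 2 * Real.pi := div_mul_cancel₀ _ hN.ne'
  refine ⟨ConvexDrawing.ofAngle θ hθ hI, fun e he => ?_⟩
  refine le_trans (Set.encard_le_encard ?_) (encard_interlaces_stackedPrism_le hn hm he)
  rintro f ⟨hf, hX⟩
  refine ⟨hf, ?_⟩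
  refine Interlaces.of_lt_iff (q := θ) hlt ?_
  have hcd : ∀ c d, s(c, d) ∈ (stackedPrism m n).edgeSet → c ≠ d :=
    fun c d h => SimpleGraph.Adj.ne ((mem_edgeSet _).1 h)
  induction e with | _ a b =>
  induction f with | _ c d =>
  rcases lt_or_gt_of_ne (hθ.ne (hcd a b he)) with h | h
  · exact ConvexDrawing.interlaces_of_crosses_ofAngle h (hcd c d hf) hX
  · rw [Sym2.eq_swap] at hX ⊢
    exact ConvexDrawing.interlaces_of_crosses_ofAngle h (hcd c d hf) hX

end PrismDrawing

end SimpleGraph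

theorem mainTheorem5 (k : ℕ) (hk : Even k) :
    (∃ M : ℕ, ∀ m : ℕ, M ≤ m → Even m →
      (SimpleGraph.stackedPrism m (k / 2 + 1)).convexLocalCrossingNumber = (k : ℕ∞) ∧
      (SimpleGraph.stackedPrism m (k / 2 + 1)).separationNumber = (k : ℕ∞) + 2) ∧
    (∀ (V : Type u) [Finite V] (G : SimpleGraph V),
      G.IsOuterKPlanar k → G.separationNumber ≤ (k : ℕ∞) + 2) := by
  refine ⟨⟨6 * (k / 2 + 1), fun m hm _ => ?_⟩, fun V _ G hG => hG.separationNumber_le⟩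
  have hk2 : 2 * (k / 2) = k := Nat.two_mul_div_two_of_even hk
  have hY : (SimpleGraph.stackedPrism m (k / 2 + 1)).IsOuterKPlanar k := by
    have := SimpleGraph.isOuterKPlanar_stackedPrism (m := m) (n := k / 2 + 1) (by omega) (by omega)
    rwa [Nat.add_sub_cancel, hk2] at this
  have hlow : ∀ s, (SimpleGraph.stackedPrism m (k / 2 + 1)).HasSubgraphSeparations s →
      k + 2 ≤ s := by
    intro s hs
    obtain ⟨A, B, hAB, hcard⟩ := hs.exists_balancedSeparation
    have := SimpleGraph.two_mul_le_ncard_of_isBalancedSeparation_stackedPrism (by omega) hm hAB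
    omega
  refine ⟨le_antisymm (iInf₂_le k hY) (le_iInf₂ fun k' hk' => ?_),
    le_antisymm hY.separationNumber_le (le_iInf₂ fun s hs => ?_)⟩
  -- Outer k'-planarity gives separations of order k' + 2, so k + 2 ≤ k' + 2.
  · have := hlow _ hk'.hasSubgraphSeparations
    exact_mod_cast (by omega : k ≤ k')
  · exact_mod_cast hlow s hs
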